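/- Let $\mathbb K$ be $\mathbb R$ or $\mathbb C$; all spaces are over $\mathbb K$ and all operators are linear. For $\varepsilon>0$, an operator $T:V\to W$ between normed spaces is an \emph{$\varepsilon$-isometry} if $(1+\varepsilon)^{-1}\|x\|\le\|Tx\|\le(1+\varepsilon)\|x\|$ for all $x\in V$. Banach spaces $V,W$ are \emph{almost isometric} if for every $\varepsilon>0$ there is an $\varepsilon$-isometry of $V$ onto $W$. A Banach space $X$ is a \emph{Gurariy space} if for every $\varepsilon>0$ and all finite-dimensional normed spaces $E\subseteq F$, every isometry $E\to X$ (not necessarily onto) extends to an $\varepsilon$-isometry $F\to X$. A closed linear subspace $Y$ of a Banach space $X$ is an \emph{almost isometric ideal} (a.i.-ideal) in $X$ if for every $\varepsilon>0$ and every finite-dimensional subspace $E\subseteq X$ there is an $\varepsilon$-isometry $T:E\to Y$ with $Te=e$ for all $e\in E\cap Y$. \textbf{Theorem.} A separable Gurariy space exists. Moreover, if $\mathbb G$ is any separable Gurariy space (the separable Gurariy space is unique up to isometry), then a Banach space $X$, separable or not, is a Gurariy space if and only if every separable a.i.-ideal in $X$ is almost isometric to $\mathbb G$. -/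

import Mathlib

universe u v w

namespace GurariySpace

/-- A linear operator `T` is an `ε`-isometry (not necessarily onto) if
`(1 + ε)⁻¹ ‖x‖ ≤ ‖T x‖ ≤ (1 + ε) ‖x‖` for all `x`. -/
def IsEpsIsometry {𝕜 : Type u} [RCLike 𝕜] {V : Type v} [NormedAddCommGroup V] [NormedSpace 𝕜 V]
    {W : Type w} [NormedAddCommGroup W] [NormedSpace 𝕜 W] (ε : ℝ) (T : V →ₗ[𝕜] W) : Prop :=
  ∀ x : V, (1 + ε)⁻¹ * ‖x‖ ≤ ‖T x‖ ∧ ‖T x‖ ≤ (1 + ε) * ‖x‖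

/-- `V` and `W` are almost isometric if for every `ε > 0` there is an `ε`-isometry of `V` onto
`W`. -/
def AlmostIsometric (𝕜 : Type u) [RCLike 𝕜] (V : Type v) [NormedAddCommGroup V] [NormedSpace 𝕜 V]
    (W : Type w) [NormedAddCommGroup W] [NormedSpace 𝕜 W] : Prop :=
  ∀ ε : ℝ, 0 < ε → ∃ T : V →ₗ[𝕜] W, IsEpsIsometry ε T ∧ Function.Surjective T

/-- The Gurariy property: for every `ε > 0` and all finite-dimensional spaces `E ⊆ F`, every
linear isometry `E → X` extends to an `ε`-isometry `F → X`.
Letting `F` range over the universe of the scalar field loses nothing: every finite-dimensional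
normed space is isometric to some `Fin n → 𝕜` with a suitable norm. -/
def IsGurariy (𝕜 : Type u) [RCLike 𝕜] (X : Type v) [NormedAddCommGroup X] [NormedSpace 𝕜 X] :
    Prop :=
  ∀ ε : ℝ, 0 < ε →
    ∀ (F : Type u) [NormedAddCommGroup F] [NormedSpace 𝕜 F] [FiniteDimensional 𝕜 F]
      (E : Submodule 𝕜 F) (T : E →ₗᵢ[𝕜] X),
      ∃ S : F →ₗ[𝕜] X, IsEpsIsometry ε S ∧ ∀ e : E, S (e : F) = T e

/-- `G` is a separable Gurariy Banach space. -/
structure IsSeparableGurariy (𝕜 : Type u) [RCLike 𝕜] (G : Type v) [NormedAddCommGroup G]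
    [NormedSpace 𝕜 G] : Prop where
  complete : CompleteSpace G
  separable : TopologicalSpace.SeparableSpace G
  gurariy : IsGurariy 𝕜 G

/-- A closed linear subspace `Y` of `X` is an almost isometric ideal in `X` if for every `ε > 0`
and every finite-dimensional subspace `E` of `X` there is an `ε`-isometry `T : E → Y` with
`T e = e` for all `e ∈ Y ∩ E`. -/
structure IsAlmostIsometricIdeal {𝕜 : Type u} [RCLike 𝕜] {X : Type v} [NormedAddCommGroup X]
    [NormedSpace 𝕜 X] (Y : Submodule 𝕜 X) : Prop where
  isClosed : IsClosed (Y : Set X)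
  exists_epsIsometry : ∀ ε : ℝ, 0 < ε → ∀ E : Submodule 𝕜 X, FiniteDimensional 𝕜 E →
    ∃ T : E →ₗ[𝕜] Y, IsEpsIsometry ε T ∧ ∀ e : E, (e : X) ∈ Y → (T e : X) = e

end GurariySpace

open Module

namespace GurariySpace

/-! ### Calculus of ε-isometries. -/

section EpsIsometry

variable {𝕜 : Type*} [RCLike 𝕜] {V : Type*} [NormedAddCommGroup V] [NormedSpace 𝕜 V]
  {W : Type*} [NormedAddCommGroup W] [NormedSpace 𝕜 W]
  {Z : Type*} [NormedAddCommGroup Z] [NormedSpace 𝕜 Z] {ε δ η : ℝ}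

/-! Renorming turns an ε-isometry on a subspace into an isometry, so a Gurariy space also extends
ε-isometries, with arbitrarily small loss (`IsGurariy.exists_extension`). Hence the property passes
to almost isometric copies, and a back-and-forth argument makes any two separable Gurariy spaces
almost isometric. It also passes to a.i.-ideals: extend into `X`, then push the finite-dimensional
range back into the ideal. This gives the forward implication.

Conversely, a Löwenheim–Skolem closing-off puts every separable subspace inside a separable
a.i.-ideal (`exists_separable_isAlmostIsometricIdeal`). The range of a finite-dimensional isometry
thus lies in an ideal almost isometric to `G`, where it can be extended.

For existence, the limit of a tower of `ℓ^∞` spaces, each solving all extension problems of the one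
before, is a large Gurariy space; any separable a.i.-ideal in it is as required. -/

theorem isEpsIsometry_iff (hε : 0 ≤ ε) {T : V →ₗ[𝕜] W} :
    IsEpsIsometry ε T ↔ ∀ x, ‖T x‖ ≤ (1 + ε) * ‖x‖ ∧ ‖x‖ ≤ (1 + ε) * ‖T x‖ := by
  have h : 0 < 1 + ε := by linarith
  simp only [IsEpsIsometry, inv_mul_le_iff₀ h]
  exact forall_congr' fun x => and_comm

theorem IsEpsIsometry.comp (hε : 0 ≤ ε) (hδ : 0 ≤ δ) (h : (1 + ε) * (1 + δ) ≤ 1 + η)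
    {S : W →ₗ[𝕜] Z} {T : V →ₗ[𝕜] W} (hS : IsEpsIsometry ε S) (hT : IsEpsIsometry δ T) :
    IsEpsIsometry η (S ∘ₗ T) := by
  have hη : 0 ≤ η := by nlinarith [mul_nonneg hε hδ]
  rw [isEpsIsometry_iff hη]
  rw [isEpsIsometry_iff hε] at hS
  rw [isEpsIsometry_iff hδ] at hT
  intro x
  have h1 := hS (T x)
  have h2 := hT x
  have h0 : 0 ≤ 1 + ε := by linarith
  have h0' : 0 ≤ 1 + δ := by linarith
  simp only [LinearMap.comp_apply]
  constructor
  · calc ‖S (T x)‖ ≤ (1 + ε) * ((1 + δ) * ‖x‖) := h1.1.trans (by gcongr; exact h2.1)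
      _ = (1 + ε) * (1 + δ) * ‖x‖ := by ring
      _ ≤ _ := by gcongr
  · calc ‖x‖ ≤ (1 + δ) * ((1 + ε) * ‖S (T x)‖) := h2.2.trans (by gcongr; exact h1.2)
      _ = (1 + ε) * (1 + δ) * ‖S (T x)‖ := by ring
      _ ≤ _ := by gcongr

theorem exists_one_add_mul_one_add_eq (hε : 0 ≤ ε) (h : ε < η) :
    ∃ δ, 0 < δ ∧ (1 + ε) * (1 + δ) = 1 + η :=
  have h1 : 0 < 1 + ε := by linarith
  ⟨(η - ε) / (1 + ε), div_pos (by linarith) h1, by field_simp; ring⟩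

theorem _root_.LinearIsometry.isEpsIsometry (T : V →ₗᵢ[𝕜] W) : IsEpsIsometry 0 T.toLinearMap := by
  intro x; simp

theorem IsEpsIsometry.injective (hε : 0 ≤ ε) {T : V →ₗ[𝕜] W} (hT : IsEpsIsometry ε T) :
    Function.Injective T := by
  rw [injective_iff_map_eq_zero]
  intro x hx
  have := ((isEpsIsometry_iff hε).1 hT x).2
  simpa [hx] using this

theorem IsEpsIsometry.symm (hε : 0 ≤ ε) {T : V ≃ₗ[𝕜] W} (hT : IsEpsIsometry ε T.toLinearMap) :
    IsEpsIsometry ε T.symm.toLinearMap := by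
  rw [isEpsIsometry_iff hε] at hT ⊢
  intro x
  simpa using (hT (T.symm x)).symm

/-- An operator close to an isometry is an `ε`-isometry. -/
theorem isEpsIsometry_of_abs_sub_le (hε : 0 ≤ ε) {T : V →ₗ[𝕜] W}
    (h : ∀ x, |‖T x‖ - ‖x‖| ≤ ε / (1 + ε) * ‖x‖) : IsEpsIsometry ε T := by
  have h1 : 0 < 1 + ε := by linarith
  intro x
  have := abs_le.1 (h x)
  have h2 : ε / (1 + ε) ≤ ε := div_le_self hε (by linarith)
  -- The tolerance is dictated by the lower bound; the upper one has slack.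
  have h3 : (1 + ε)⁻¹ = 1 - ε / (1 + ε) := by field_simp; ring
  rw [h3]
  constructor
  · nlinarith [norm_nonneg x]
  · nlinarith [norm_nonneg x, mul_le_mul_of_nonneg_right h2 (norm_nonneg x)]

end EpsIsometry

/-! ### Renorming: from ε-isometries to isometries. -/

section Renorming

variable {𝕜 : Type*} [RCLike 𝕜] {F : Type*} [NormedAddCommGroup F] [NormedSpace 𝕜 F]
  {W : Type*} [NormedAddCommGroup W] [NormedSpace 𝕜 W] {E : Submodule 𝕜 F} {ε : ℝ}

theorem bddBelow_range_renorm (hε : 0 ≤ ε) (T : E →ₗ[𝕜] W) (x : F) :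
    BddBelow (Set.range fun w : E => (1 + ε) * ‖x - w‖ + ‖T w‖) :=
  ⟨0, by rintro _ ⟨w, rfl⟩; positivity⟩

/-- The largest seminorm that is at most `(1 + ε) ‖x‖` on `F` and at most `‖T x‖` on `E`. -/
noncomputable def renorm (hε : 0 ≤ ε) (T : E →ₗ[𝕜] W) : Seminorm 𝕜 F :=
  Seminorm.ofSMulLE (fun x => ⨅ w : E, (1 + ε) * ‖x - w‖ + ‖T w‖)
    (le_antisymm ((ciInf_le (bddBelow_range_renorm hε T 0) 0).trans (by simp))
      (Real.iInf_nonneg fun w => by positivity))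
    (fun x y => by
      refine le_ciInf_add_ciInf fun w z => ?_
      refine (ciInf_le (bddBelow_range_renorm hε T (x + y)) (w + z)).trans ?_
      have h1 : ‖x + y - (w + z : E)‖ ≤ ‖x - w‖ + ‖y - z‖ := by
        rw [Submodule.coe_add, add_sub_add_comm]; exact norm_add_le _ _
      have h2 : ‖T (w + z)‖ ≤ ‖T w‖ + ‖T z‖ := by rw [map_add]; exact norm_add_le _ _
      nlinarith)
    (fun c x => by
      rw [Real.mul_iInf_of_nonneg (norm_nonneg c)]
      refine le_ciInf fun w => (ciInf_le (bddBelow_range_renorm hε T (c • x)) (c • w)).trans ?_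
      rw [Submodule.coe_smul, ← smul_sub, map_smul, norm_smul, norm_smul]
      apply le_of_eq; ring)

theorem renorm_apply (hε : 0 ≤ ε) (T : E →ₗ[𝕜] W) (x : F) :
    renorm hε T x = ⨅ w : E, ((1 + ε) * ‖x - w‖ + ‖T w‖) := rfl

theorem renorm_le (hε : 0 ≤ ε) (T : E →ₗ[𝕜] W) (x : F) : renorm hε T x ≤ (1 + ε) * ‖x‖ :=
  (ciInf_le (bddBelow_range_renorm hε T x) 0).trans (by simp)

theorem le_renorm (hε : 0 ≤ ε) {T : E →ₗ[𝕜] W} (hT : IsEpsIsometry ε T) (x : F) :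
    ‖x‖ ≤ (1 + ε) * renorm hε T x := by
  have h1 : 0 < 1 + ε := by linarith
  rw [renorm_apply, Real.mul_iInf_of_nonneg h1.le]
  refine le_ciInf fun w => ?_
  have h2 := ((isEpsIsometry_iff hε).1 hT w).2
  have h3 : ‖x‖ ≤ ‖x - w‖ + ‖(w : F)‖ := by simpa using norm_add_le (x - w) (w : F)
  have h4 : ‖(w : F)‖ = ‖w‖ := rfl
  have h5 : ‖x - w‖ ≤ (1 + ε) * ((1 + ε) * ‖x - w‖) := by
    have := norm_nonneg (x - w)
    nlinarith [mul_nonneg hε this, mul_nonneg hε (mul_nonneg hε this)]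
  linarith

/-- The weight `1 + ε` in `renorm` bounds `T`, so `‖T e‖ ≤ (1 + ε) * ‖e - w‖ + ‖T w‖` and the
infimum is attained at `w = e`. -/
theorem renorm_coe (hε : 0 ≤ ε) {T : E →ₗ[𝕜] W} (hT : IsEpsIsometry ε T) (e : E) :
    renorm hε T e = ‖T e‖ := by
  refine le_antisymm ((ciInf_le (bddBelow_range_renorm hε T e) e).trans (by simp)) ?_
  refine le_ciInf fun w => ?_
  have h2 := ((isEpsIsometry_iff hε).1 hT (e - w)).1
  have h3 : ‖T e‖ ≤ ‖T (e - w)‖ + ‖T w‖ := by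
    rw [map_sub]; simpa using norm_add_le (T e - T w) (T w)
  have h4 : ‖(e : F) - w‖ = ‖e - w‖ := rfl
  rw [h4]; linarith

/-- An `ε`-isometry defined on a subspace becomes an isometry after a renorming of the whole
space. -/
theorem exists_renorming [Small.{u} F] (hε : 0 ≤ ε) {T : E →ₗ[𝕜] W} (hT : IsEpsIsometry ε T) :
    ∃ (F' : Type u) (_ : NormedAddCommGroup F') (_ : NormedSpace 𝕜 F') (φ : F ≃ₗ[𝕜] F'),
      IsEpsIsometry ε φ.toLinearMap ∧ ∀ e : E, ‖φ e‖ = ‖T e‖ := by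
  -- The new norm is put on a copy of `F` in the universe over which `IsGurariy` quantifies.
  obtain ⟨F', _, _, ⟨ψ⟩⟩ : ∃ (F' : Type u) (_ : AddCommGroup F') (_ : Module 𝕜 F'),
      Nonempty (F' ≃ₗ[𝕜] F) := ⟨Shrink.{u} F, inferInstance, inferInstance, ⟨Shrink.linearEquiv 𝕜 F⟩⟩
  let _ : Norm F' := ⟨fun x => renorm hε T (ψ x)⟩
  have core : NormedSpace.Core 𝕜 F' :=
    { norm_nonneg := fun x => apply_nonneg _ _
      norm_smul := fun c x => by
        change renorm hε T (ψ (c • x)) = ‖c‖ * renorm hε T (ψ x)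
        rw [map_smul, map_smul_eq_mul]
      norm_triangle := fun x y => by
        change renorm hε T (ψ (x + y)) ≤ renorm hε T (ψ x) + renorm hε T (ψ y)
        rw [map_add]; exact map_add_le_add _ _ _
      norm_eq_zero_iff := fun x => by
        change renorm hε T (ψ x) = 0 ↔ x = 0
        refine ⟨fun h => ?_, fun h => by simp [h]⟩
        have := le_renorm hε hT (ψ x)
        simpa [h] using this }
  let i₁ : NormedAddCommGroup F' := NormedAddCommGroup.ofCore core
  let i₂ : NormedSpace 𝕜 F' := NormedSpace.ofCore core
  refine ⟨F', i₁, i₂, ψ.symm, ?_, ?_⟩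
  · refine (isEpsIsometry_iff hε).2 fun x => ?_
    change renorm hε T (ψ (ψ.symm x)) ≤ _ ∧ _ ≤ _ * renorm hε T (ψ (ψ.symm x))
    rw [LinearEquiv.apply_symm_apply]
    exact ⟨renorm_le hε T x, le_renorm hε hT x⟩
  · intro e
    change renorm hε T (ψ (ψ.symm e)) = _
    rw [LinearEquiv.apply_symm_apply, renorm_coe hε hT]

end Renorming

/-! ### Extension of ε-isometries and permanence of the Gurariy property. -/

section Gurariy

variable {𝕜 : Type u} [RCLike 𝕜] {X : Type v} [NormedAddCommGroup X] [NormedSpace 𝕜 X]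
  {F : Type*} [NormedAddCommGroup F] [NormedSpace 𝕜 F] {ε η : ℝ}

theorem small_of_finiteDimensional [FiniteDimensional 𝕜 F] : Small.{u} F :=
  small_map (finBasis 𝕜 F).equivFun.toEquiv

/-- In a Gurariy space every `ε`-isometry extends, with an arbitrarily small loss. -/
theorem IsGurariy.exists_extension (hX : IsGurariy 𝕜 X) [FiniteDimensional 𝕜 F]
    {E : Submodule 𝕜 F} (hε : 0 ≤ ε) (hη : ε < η) {T : E →ₗ[𝕜] X} (hT : IsEpsIsometry ε T) :
    ∃ S : F →ₗ[𝕜] X, IsEpsIsometry η S ∧ ∀ e : E, S e = T e := by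
  have : Small.{u} F := small_of_finiteDimensional (𝕜 := 𝕜)
  obtain ⟨F', _, _, φ, hφ, hφE⟩ := exists_renorming.{u} hε hT
  have : FiniteDimensional 𝕜 F' := φ.finiteDimensional
  obtain ⟨δ, hδ, hδη⟩ := exists_one_add_mul_one_add_eq hε hη
  let ψ := φ.submoduleMap E
  let T' : (E.map (φ : F →ₗ[𝕜] F')) →ₗᵢ[𝕜] X :=
    { toLinearMap := T ∘ₗ ψ.symm.toLinearMap
      norm_map' := fun x => by
        obtain ⟨e, rfl⟩ := ψ.surjective x
        simp only [LinearMap.comp_apply, LinearEquiv.coe_coe, LinearEquiv.symm_apply_apply]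
        exact (hφE e).symm }
  obtain ⟨S, hS, hST⟩ := hX δ hδ F' _ T'
  refine ⟨S ∘ₗ φ.toLinearMap, hS.comp hδ.le hε (by linarith) hφ, fun e => ?_⟩
  have := hST (ψ e)
  have h2 : T' (ψ e) = T e := by
    change T (ψ.symm (ψ e)) = T e
    rw [LinearEquiv.symm_apply_apply]
  rw [h2] at this
  exact this

theorem IsGurariy.of_isAlmostIsometricIdeal (hX : IsGurariy 𝕜 X) {Y : Submodule 𝕜 X}
    (hY : IsAlmostIsometricIdeal Y) : IsGurariy 𝕜 Y := by
  intro ε hε F _ _ _ E T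
  obtain ⟨δ, hδ, hδε⟩ := exists_one_add_mul_one_add_eq (half_pos hε).le (half_lt_self hε)
  obtain ⟨S, hS, hST⟩ := hX δ hδ F E (Y.subtypeₗᵢ.comp T)
  obtain ⟨R, hR, hRY⟩ := hY.exists_epsIsometry _ (half_pos hε) (LinearMap.range S) inferInstance
  have hS' : IsEpsIsometry δ S.rangeRestrict := hS
  refine ⟨R ∘ₗ S.rangeRestrict, hR.comp (half_pos hε).le hδ.le hδε.le hS', fun e => ?_⟩
  have h1 : S e = (T e : X) := hST e
  apply Subtype.ext
  have := hRY (S.rangeRestrict e) (by simp [h1])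
  rw [LinearMap.comp_apply, this]
  exact h1

theorem IsGurariy.of_almostIsometric {G : Type w} [NormedAddCommGroup G] [NormedSpace 𝕜 G]
    (hG : IsGurariy 𝕜 G) (h : AlmostIsometric 𝕜 X G) : IsGurariy 𝕜 X := by
  intro ε hε F _ _ _ E T
  obtain ⟨δ, hδ, hδε⟩ := exists_one_add_mul_one_add_eq (half_pos hε).le (half_lt_self hε)
  have hδ2 := half_pos hδ
  obtain ⟨η, hη, hηδ⟩ := exists_one_add_mul_one_add_eq le_rfl hδ
  -- `R ∘ T` is only a `δ / 2`-isometry; its extension loses up to `δ`, and the bound `ε / 2` pays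
  -- for returning by the inverse of `R`.
  obtain ⟨R, hR, hRs⟩ := h (min (δ / 2) (ε / 2)) (lt_min hδ2 (half_pos hε))
  have hm : 0 ≤ min (δ / 2) (ε / 2) := le_min hδ2.le (half_pos hε).le
  let R' := LinearEquiv.ofBijective R ⟨hR.injective hm, hRs⟩
  have hR' : IsEpsIsometry (min (δ / 2) (ε / 2)) R'.toLinearMap := hR
  have hRT : IsEpsIsometry (δ / 2) (R ∘ₗ T.toLinearMap) :=
    hR.comp hm le_rfl (by linarith [min_le_left (δ / 2) (ε / 2)]) T.isEpsIsometry
  obtain ⟨S, hS, hST⟩ := hG.exists_extension hδ2.le (half_lt_self hδ) hRT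
  refine ⟨R'.symm.toLinearMap ∘ₗ S, (hR'.symm hm).comp hm hδ.le ?_ hS, fun e => ?_⟩
  · rw [← hδε]
    have := min_le_right (δ / 2) (ε / 2)
    gcongr
  · change R'.symm (S e) = T e
    rw [LinearEquiv.symm_apply_eq, hST e]
    rfl

end Gurariy

/-! ### Back-and-forth between separable Gurariy spaces. -/

section BackAndForth

variable {𝕜 : Type u} [RCLike 𝕜] {X : Type v} [NormedAddCommGroup X] [NormedSpace 𝕜 X]
  {Y : Type w} [NormedAddCommGroup Y] [NormedSpace 𝕜 Y] {ε η : ℝ}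

/-- `Γ` is the graph of an `ε`-isometry between a subspace of `X` and a subspace of `Y`. -/
def IsEpsGraph (ε : ℝ) (Γ : Submodule 𝕜 (X × Y)) : Prop :=
  ∀ p ∈ Γ, ‖p.2‖ ≤ (1 + ε) * ‖p.1‖ ∧ ‖p.1‖ ≤ (1 + ε) * ‖p.2‖

theorem IsEpsGraph.mono {Γ : Submodule 𝕜 (X × Y)} (h : ε ≤ η) (hΓ : IsEpsGraph ε Γ) :
    IsEpsGraph η Γ := fun p hp =>
  ⟨(hΓ p hp).1.trans (by gcongr), (hΓ p hp).2.trans (by gcongr)⟩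

theorem IsEpsGraph.swap {Γ : Submodule 𝕜 (X × Y)} (hΓ : IsEpsGraph ε Γ) :
    IsEpsGraph ε (Γ.map (LinearEquiv.prodComm 𝕜 X Y).toLinearMap) := by
  rintro _ ⟨p, hp, rfl⟩
  exact (hΓ p hp).symm

theorem IsEpsGraph.injective_fst {Γ : Submodule 𝕜 (X × Y)} (hΓ : IsEpsGraph ε Γ) :
    Function.Injective ((LinearMap.fst 𝕜 X Y).domRestrict Γ) := by
  rw [injective_iff_map_eq_zero]
  rintro ⟨p, hp⟩ h
  have h1 : p.1 = 0 := h
  have h2 := (hΓ p hp).1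
  rw [h1, norm_zero, mul_zero, norm_le_zero_iff] at h2
  exact Subtype.ext (Prod.ext h1 h2)

theorem IsEpsGraph.topologicalClosure {Γ : Submodule 𝕜 (X × Y)} (hΓ : IsEpsGraph ε Γ) :
    IsEpsGraph ε Γ.topologicalClosure := by
  have hc : IsClosed {p : X × Y | ‖p.2‖ ≤ (1 + ε) * ‖p.1‖ ∧ ‖p.1‖ ≤ (1 + ε) * ‖p.2‖} := by
    rw [Set.ofPred_and]
    exact (isClosed_le (by fun_prop) (by fun_prop)).inter
      (isClosed_le (by fun_prop) (by fun_prop))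
  exact fun p hp => closure_minimal (fun p hp => hΓ p hp) hc hp

/-- `Γ` is read as an ε-isometry on its first projection and extended to one more vector. Graphs
keep the two spaces symmetric, so the other half-step is a swap. -/
theorem IsGurariy.exists_graph_extension (hY : IsGurariy 𝕜 Y) {Γ : Submodule 𝕜 (X × Y)}
    [FiniteDimensional 𝕜 Γ] (hε : 0 ≤ ε) (hη : ε < η) (hΓ : IsEpsGraph ε Γ) (x : X) :
    ∃ Γ' : Submodule 𝕜 (X × Y), FiniteDimensional 𝕜 Γ' ∧ Γ ≤ Γ' ∧ IsEpsGraph η Γ' ∧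
      ∃ y, (x, y) ∈ Γ' := by
  set f := (LinearMap.fst 𝕜 X Y).domRestrict Γ with hf
  let F : Submodule 𝕜 X := LinearMap.range f ⊔ Submodule.span 𝕜 {x}
  have hF : LinearMap.range f ≤ F := le_sup_left
  let g : (LinearMap.range f).comap F.subtype ≃ₗ[𝕜] Γ :=
    (Submodule.comapSubtypeEquivOfLe hF).trans (LinearEquiv.ofInjective f hΓ.injective_fst).symm
  have hg : ∀ e, ((g e : X × Y)).1 = ((e : F) : X) := fun e =>
    congrArg Subtype.val ((LinearEquiv.ofInjective f hΓ.injective_fst).apply_symm_apply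
      (Submodule.comapSubtypeEquivOfLe hF e))
  let T : (LinearMap.range f).comap F.subtype →ₗ[𝕜] Y :=
    LinearMap.snd 𝕜 X Y ∘ₗ Γ.subtype ∘ₗ g.toLinearMap
  have hT : IsEpsIsometry ε T := (isEpsIsometry_iff hε).2 fun e => by
    have h := hΓ (g e) (g e).2
    rw [hg e] at h
    exact h
  obtain ⟨S, hS, hST⟩ := hY.exists_extension hε hη hT
  refine ⟨LinearMap.range (F.subtype.prod S), inferInstance, fun p hp => ?_, ?_, ?_⟩
  · let e := g.symm ⟨p, hp⟩
    have he : g e = ⟨p, hp⟩ := g.apply_symm_apply _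
    refine ⟨e, Prod.ext ?_ ?_⟩
    · change ((e : F) : X) = p.1
      rw [← hg e, he]
    · change S e = p.2
      rw [hST e]
      change (g e : X × Y).2 = p.2
      rw [he]
  · rintro _ ⟨z, rfl⟩
    exact (isEpsIsometry_iff (hε.trans hη.le)).1 hS z
  · have hx : x ∈ F := Submodule.mem_sup_right (Submodule.mem_span_singleton_self x)
    exact ⟨S ⟨x, hx⟩, ⟨x, hx⟩, rfl⟩

theorem IsGurariy.exists_graph_extension₂ (hX : IsGurariy 𝕜 X) (hY : IsGurariy 𝕜 Y)
    {Γ : Submodule 𝕜 (X × Y)} [FiniteDimensional 𝕜 Γ] (hε : 0 ≤ ε) (hη : ε < η)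
    (hΓ : IsEpsGraph ε Γ) (x : X) (y : Y) :
    ∃ Γ' : Submodule 𝕜 (X × Y), FiniteDimensional 𝕜 Γ' ∧ Γ ≤ Γ' ∧ IsEpsGraph η Γ' ∧
      (∃ y', (x, y') ∈ Γ') ∧ ∃ x', (x', y) ∈ Γ' := by
  obtain ⟨δ, hεδ, hδη⟩ := exists_between hη
  obtain ⟨Γ₁, _, hle₁, hΓ₁, y', hy'⟩ := hY.exists_graph_extension hε hεδ hΓ x
  obtain ⟨Γ₂, _, hle₂, hΓ₂, x', hx'⟩ :=
    hX.exists_graph_extension (hε.trans hεδ.le) hδη hΓ₁.swap y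
  have hle : Γ₁ ≤ Γ₂.map (LinearEquiv.prodComm 𝕜 Y X).toLinearMap := fun p hp =>
    ⟨p.swap, hle₂ ⟨p, hp, rfl⟩, rfl⟩
  exact ⟨_, inferInstance, hle₁.trans hle, hΓ₂.swap, ⟨y', hle hy'⟩, x', ⟨_, hx', rfl⟩⟩

/-- On a graph the first coordinate controls the norm, so the projection is antilipschitz; its range
is closed as well as dense. -/
theorem IsEpsGraph.surjective_fst [CompleteSpace X] [CompleteSpace Y] {Γ : Submodule 𝕜 (X × Y)}
    (hε : 0 ≤ ε) (hΓ : IsEpsGraph ε Γ) (hc : IsClosed (Γ : Set (X × Y)))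
    (hd : DenseRange fun p : Γ => (p : X × Y).1) (x : X) : ∃ y, (x, y) ∈ Γ := by
  have hcomp : CompleteSpace Γ := hc.completeSpace_coe
  let f := (LinearMap.fst 𝕜 X Y).domRestrict Γ
  have ha : AntilipschitzWith (1 + ε).toNNReal f :=
    AddMonoidHomClass.antilipschitz_of_bound f fun p => by
      rw [Real.coe_toNNReal _ (by linarith)]
      have h := hΓ p p.2
      change max ‖(p : X × Y).1‖ ‖(p : X × Y).2‖ ≤ (1 + ε) * ‖(p : X × Y).1‖
      exact max_le (by nlinarith [mul_nonneg hε (norm_nonneg (p : X × Y).1)]) h.1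
  have hu : UniformContinuous f := uniformContinuous_fst.comp uniformContinuous_subtype_val
  have hr : Set.range f = Set.univ := by
    rw [← (ha.isClosed_range hu).closure_eq]
    exact hd.closure_range
  obtain ⟨p, hp⟩ := Set.range_eq_univ.1 hr x
  exact ⟨(p : X × Y).2, by rw [← hp]; exact p.2⟩

/-- Two separable Gurariy spaces are almost isometric. -/
theorem IsSeparableGurariy.almostIsometric (hX : IsSeparableGurariy 𝕜 X)
    (hY : IsSeparableGurariy 𝕜 Y) : AlmostIsometric 𝕜 X Y := by
  intro ε hε
  have := hX.complete; have := hX.separable; have := hY.complete; have := hY.separable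
  -- Constants stay strictly below `ε`, leaving room for the loss at each extension.
  let P := {Γ : Submodule 𝕜 (X × Y) // FiniteDimensional 𝕜 Γ ∧ ∃ η, 0 ≤ η ∧ η < ε ∧
    IsEpsGraph η Γ}
  have step : ∀ (n : ℕ) (Γ : P), ∃ Γ' : P, Γ.1 ≤ Γ'.1 ∧
      (∃ y, (TopologicalSpace.denseSeq X n, y) ∈ Γ'.1) ∧
      ∃ x, (x, TopologicalSpace.denseSeq Y n) ∈ Γ'.1 := by
    rintro n ⟨Γ, _, η, hη, hηε, hΓ⟩
    obtain ⟨δ, hηδ, hδε⟩ := exists_between hηε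
    obtain ⟨Γ', h1, h2, h3, h4, h5⟩ := hX.gurariy.exists_graph_extension₂ hY.gurariy hη hηδ hΓ
      (TopologicalSpace.denseSeq X n) (TopologicalSpace.denseSeq Y n)
    exact ⟨⟨Γ', h1, δ, hη.trans hηδ.le, hδε, h3⟩, h2, h4, h5⟩
  choose next hle hx hy using step
  let Γ₀ : P := ⟨⊥, inferInstance, 0, le_rfl, hε, fun p hp => by
    rw [(Submodule.mem_bot 𝕜).1 hp]; simp⟩
  let Γ : ℕ → P := fun n => Nat.rec Γ₀ (fun n Γ => next n Γ) n
  have hmono : Monotone fun n => (Γ n).1 := monotone_nat_of_le_succ fun n => hle n (Γ n)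
  let Δ := ⨆ n, (Γ n).1
  have hΔ : IsEpsGraph ε Δ := fun p hp => by
    obtain ⟨n, hn⟩ := (Submodule.mem_iSup_of_directed _ hmono.directed_le).1 hp
    obtain ⟨_, η, hη, hηε, h⟩ := (Γ n).2
    exact h.mono hηε.le p hn
  have hle' : ∀ n, (Γ n).1 ≤ Δ.topologicalClosure := fun n =>
    (le_iSup (fun n => (Γ n).1) n).trans Δ.le_topologicalClosure
  have hΔ' := hΔ.topologicalClosure
  have hc := Δ.isClosed_topologicalClosure
  have sx : ∀ x, ∃ y, (x, y) ∈ Δ.topologicalClosure := by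
    refine hΔ'.surjective_fst hε.le hc ((TopologicalSpace.denseRange_denseSeq X).mono ?_)
    rintro _ ⟨n, rfl⟩
    obtain ⟨y, h⟩ := hx n (Γ n)
    exact ⟨⟨_, hle' (n + 1) h⟩, rfl⟩
  have sy : ∀ y, ∃ x, (x, y) ∈ Δ.topologicalClosure := by
    have hc' : IsClosed ((Δ.topologicalClosure.map
        (LinearEquiv.prodComm 𝕜 X Y).toLinearMap : Submodule 𝕜 (Y × X)) : Set (Y × X)) :=
      (Homeomorph.prodComm X Y).isClosedMap _ hc
    intro y
    have := hΔ'.swap.surjective_fst hε.le hc' ((TopologicalSpace.denseRange_denseSeq Y).mono ?_) y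
    · obtain ⟨x, p, hp, h⟩ := this
      obtain rfl : p = (x, y) := congrArg Prod.swap h
      exact ⟨x, hp⟩
    rintro _ ⟨n, rfl⟩
    obtain ⟨x, h⟩ := hy n (Γ n)
    exact ⟨⟨_, _, hle' (n + 1) h, rfl⟩, rfl⟩
  let e := LinearEquiv.ofBijective _ ⟨hΔ'.injective_fst, fun x => by
    obtain ⟨y, h⟩ := sx x
    exact ⟨⟨_, h⟩, rfl⟩⟩
  refine ⟨LinearMap.snd 𝕜 X Y ∘ₗ Δ.topologicalClosure.subtype ∘ₗ e.symm.toLinearMap,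
    (isEpsIsometry_iff hε.le).2 fun x => ?_, fun y => ?_⟩
  · have h := hΔ' (e.symm x) (e.symm x).2
    have h1 : (e.symm x : X × Y).1 = x := e.apply_symm_apply x
    rw [h1] at h
    exact h
  · obtain ⟨x, h⟩ := sy y
    refine ⟨x, ?_⟩
    have h1 : e.symm x = ⟨(x, y), h⟩ := by rw [LinearEquiv.symm_apply_eq]; rfl
    simp [h1]

end BackAndForth

/-! ### Separable almost isometric ideals. -/

section SeparableIdeals

open TopologicalSpace

variable {𝕜 : Type*} [RCLike 𝕜] {X : Type*} [NormedAddCommGroup X] [NormedSpace 𝕜 X]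

/-- Finite families in `X` are approximated, in the sense of the norms of their linear
combinations, by families in `W` with the same members in `Z`. -/
def IsApproximatedBy (Z W : Submodule 𝕜 X) : Prop :=
  ∀ (n : ℕ) (x : Fin n → X) (δ : ℝ), 0 < δ → ∃ y : Fin n → X, (∀ i, y i ∈ W) ∧
    (∀ i, x i ∈ Z → y i = x i) ∧ ∀ a : Fin n → 𝕜, |‖∑ i, a i • x i‖ - ‖∑ i, a i • y i‖| ≤ δ * ‖a‖

theorem abs_norm_sum_sub_le {n : ℕ} {x y : Fin n → X} {δ : ℝ} (h : ∀ i, ‖x i - y i‖ ≤ δ)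
    (a : Fin n → 𝕜) : |‖∑ i, a i • x i‖ - ‖∑ i, a i • y i‖| ≤ n * δ * ‖a‖ := by
  refine (abs_norm_sub_norm_le _ _).trans ?_
  rw [← Finset.sum_sub_distrib]
  refine (norm_sum_le _ _).trans ?_
  have : ∀ i ∈ Finset.univ, ‖a i • x i - a i • y i‖ ≤ ‖a‖ * δ := fun i _ => by
    rw [← smul_sub, norm_smul]
    gcongr
    · exact norm_le_pi_norm a i
    · exact h i
  refine (Finset.sum_le_card_nsmul _ _ _ this).trans (le_of_eq ?_)
  simp; ring

theorem abs_norm_sum_sub_le_of_unitBall {n : ℕ} {x y : Fin n → X} {δ : ℝ}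
    (h : ∀ a : Fin n → 𝕜, ‖a‖ ≤ 1 → |‖∑ i, a i • x i‖ - ‖∑ i, a i • y i‖| ≤ δ)
    (a : Fin n → 𝕜) : |‖∑ i, a i • x i‖ - ‖∑ i, a i • y i‖| ≤ δ * ‖a‖ := by
  rcases eq_or_ne a 0 with rfl | ha
  · simp
  have ha' : 0 < ‖a‖ := norm_pos_iff.2 ha
  have hb : ‖((‖a‖ : 𝕜)⁻¹ • a)‖ ≤ 1 := by
    rw [norm_smul, norm_inv, RCLike.norm_ofReal, abs_norm, inv_mul_cancel₀ ha'.ne']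
  have key : ∀ z : Fin n → X, ‖∑ i, a i • z i‖ = ‖a‖ * ‖∑ i, ((‖a‖ : 𝕜)⁻¹ • a) i • z i‖ := by
    intro z
    simp only [Pi.smul_apply, smul_assoc, ← Finset.smul_sum]
    rw [norm_smul, norm_inv, RCLike.norm_ofReal, abs_norm, mul_inv_cancel_left₀ ha'.ne']
  rw [key x, key y, ← mul_sub, abs_mul, abs_norm, mul_comm]
  gcongr
  exact h _ hb

theorem exists_countable_forall_dist_lt {A M : Type*} [PseudoMetricSpace M]
    [SecondCountableTopology M] (Φ : A → M) :
    ∃ C : Set A, C.Countable ∧ ∀ a, ∀ δ > 0, ∃ c ∈ C, dist (Φ a) (Φ c) < δ := by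
  let _ : PseudoMetricSpace A := PseudoMetricSpace.induced Φ ‹_›
  have : SecondCountableTopology A := secondCountableTopology_induced A M Φ
  obtain ⟨C, hC, hd⟩ := exists_countable_dense A
  exact ⟨C, hC, fun a δ hδ => hd.exists_dist_lt a hδ⟩

/-- A tuple is recorded by its entries in `Z` and its norm function on the unit ball of `Fin n → 𝕜`.
These data lie in a separable metric space, so countably many tuples suffice, and their entries are
adjoined to `Z`. -/
theorem exists_isApproximatedBy {Z : Submodule 𝕜 X} (hZ : IsSeparable (Z : Set X)) :
    ∃ W : Submodule 𝕜 X, Z ≤ W ∧ IsSeparable (W : Set X) ∧ IsApproximatedBy Z W := by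
  classical
  have : SeparableSpace Z := hZ.separableSpace
  have : SecondCountableTopology Z := UniformSpace.secondCountable_of_separable Z
  let K := fun n => Metric.closedBall (0 : Fin n → 𝕜) 1
  have hK : ∀ n, CompactSpace (K n) := fun n =>
    isCompact_iff_compactSpace.1 (isCompact_closedBall _ _)
  let A := fun (n : ℕ) (s : Finset (Fin n)) => {x : Fin n → X // ∀ i ∈ s, x i ∈ Z}
  let Φ : ∀ n s, A n s → (s → Z) × C(K n, ℝ) := fun n s x =>
    ⟨fun i => ⟨x.1 i, x.2 i i.2⟩, ⟨fun a => ‖∑ i, (a : Fin n → 𝕜) i • x.1 i‖,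
      continuous_norm.comp (continuous_finsetSum _ fun i _ =>
        ((continuous_apply i).comp continuous_subtype_val).smul continuous_const)⟩⟩
  choose C hC hCd using fun n s => exists_countable_forall_dist_lt (Φ n s)
  let D : Set X := ⋃ (n : ℕ) (s : Finset (Fin n)) (i : Fin n), (fun x : A n s => x.1 i) '' C n s
  have hD : D.Countable := Set.countable_iUnion fun n => Set.countable_iUnion fun s =>
    Set.countable_iUnion fun i => (hC n s).image _
  refine ⟨Submodule.span 𝕜 (Z ∪ D), fun z hz => Submodule.subset_span (Or.inl hz),
    (hZ.union hD.isSeparable).span, fun n x δ hδ => ?_⟩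
  let s : Finset (Fin n) := Finset.univ.filter fun i => x i ∈ Z
  have hs : ∀ i, i ∈ s ↔ x i ∈ Z := fun i => by simp [s]
  -- One share of `δ` covers the norm functions, `n` shares the restoring of the exact entries in
  -- `Z`.
  obtain ⟨c, hc, hd⟩ := hCd n s ⟨x, fun i hi => (hs i).1 hi⟩ (δ / (n + 1)) (by positivity)
  rw [Prod.dist_eq, max_lt_iff] at hd
  refine ⟨fun i => if i ∈ s then x i else c.1 i, fun i => ?_, fun i hi => if_pos ((hs i).2 hi), ?_⟩
  · dsimp only
    split_ifs with h
    · exact Submodule.subset_span (Or.inl ((hs i).1 h))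
    · exact Submodule.subset_span (Or.inr (Set.mem_iUnion.2 ⟨n, Set.mem_iUnion.2 ⟨s,
        Set.mem_iUnion.2 ⟨i, c, hc, rfl⟩⟩⟩))
  intro a
  have h1 := abs_norm_sum_sub_le_of_unitBall (x := x) (y := c.1) (fun b hb =>
    (ContinuousMap.dist_apply_le_dist (f := (Φ n s ⟨x, fun i hi => (hs i).1 hi⟩).2)
      (g := (Φ n s c).2) ⟨b, by simpa [K] using hb⟩).trans hd.2.le) a
  have h2 := abs_norm_sum_sub_le (𝕜 := 𝕜) (x := c.1)
    (y := fun i => if i ∈ s then x i else c.1 i) (δ := δ / (n + 1)) (fun i => by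
      split_ifs with h
      · have := (dist_le_pi_dist _ _ (⟨i, h⟩ : s)).trans hd.1.le
        rw [dist_comm, Subtype.dist_eq, dist_eq_norm] at this
        exact this
      · rw [sub_self, norm_zero]; positivity) a
  calc _ ≤ _ := abs_sub_le _ (‖∑ i, a i • c.1 i‖) _
    _ ≤ δ / (n + 1) * ‖a‖ + n * (δ / (n + 1)) * ‖a‖ := add_le_add h1 h2
    _ = δ * ‖a‖ := by field_simp; ring

theorem isApproximatedBy_topologicalClosure_iSup {Z : ℕ → Submodule 𝕜 X} (hZ : Monotone Z)
    (h : ∀ n, IsApproximatedBy (Z n) (Z (n + 1))) :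
    IsApproximatedBy (⨆ n, Z n).topologicalClosure (⨆ n, Z n).topologicalClosure := by
  classical
  intro n x δ hδ
  set Y := (⨆ n, Z n).topologicalClosure
  -- Entries in `Y` are moved into some `Z M` (cost `n * η`), the tuple is approximated in `Z (M +
  -- 1)` (cost `η`), and those entries are restored (cost `n * η`).
  set η := δ / (2 * n + 1) with hη
  have hη0 : 0 < η := by positivity
  have h1 : ∀ i, ∃ z : X, ‖x i - z‖ ≤ η ∧ (x i ∈ Y → ∃ N, z ∈ Z N) := fun i => by
    by_cases hi : x i ∈ Y
    · obtain ⟨z, hz, hd⟩ := Metric.mem_closure_iff.1 hi η hη0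
      rw [dist_eq_norm] at hd
      exact ⟨z, hd.le, fun _ => (Submodule.mem_iSup_of_directed _ hZ.directed_le).1 hz⟩
    · exact ⟨x i, by simpa using hη0.le, fun h => absurd h hi⟩
  choose z hz N hN using h1
  let M := Finset.univ.sup fun i => if h : x i ∈ Y then N i h else 0
  have hM : ∀ i, x i ∈ Y → z i ∈ Z M := fun i hi => by
    have : N i hi ≤ M := by
      have := Finset.le_sup (f := fun i => if h : x i ∈ Y then N i h else 0) (Finset.mem_univ i)
      simpa [hi] using this
    exact hZ this (hN i hi)
  obtain ⟨y, hyW, hyz, hy⟩ := h M n z η hη0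
  have hZY : ∀ k, Z k ≤ Y := fun k => (le_iSup Z k).trans (Submodule.le_topologicalClosure _)
  refine ⟨fun i => if x i ∈ Y then x i else y i, fun i => ?_, fun i hi => if_pos hi, fun a => ?_⟩
  · dsimp only
    split_ifs with h
    · exact h
    · exact hZY _ (hyW i)
  have e1 := abs_norm_sum_sub_le hz a
  have e2 := abs_norm_sum_sub_le (𝕜 := 𝕜) (x := y) (y := fun i => if x i ∈ Y then x i else y i)
    (δ := η) (fun i => by
      split_ifs with h
      · rw [hyz i (hM i h), norm_sub_rev]; exact hz i
      · simpa using hη0.le) a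
  calc _ ≤ _ := abs_sub_le _ (‖∑ i, a i • z i‖) _
    _ ≤ _ := add_le_add_right (abs_sub_le _ (‖∑ i, a i • y i‖) _) _
    _ ≤ n * η * ‖a‖ + (η * ‖a‖ + n * η * ‖a‖) := add_le_add e1 (add_le_add (hy a) e2)
    _ = δ * ‖a‖ := by rw [hη]; field_simp; ring

theorem IsApproximatedBy.isAlmostIsometricIdeal {Y : Submodule 𝕜 X} (hY : IsApproximatedBy Y Y)
    (hc : IsClosed (Y : Set X)) : IsAlmostIsometricIdeal Y := by
  refine ⟨hc, fun ε hε E _ => ?_⟩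
  let E' : Submodule 𝕜 E := Y.comap E.subtype
  obtain ⟨C, hC⟩ := E'.exists_isCompl
  -- The basis is adapted to `E ∩ Y`: an operator fixing its members in `Y` fixes all of `E ∩ Y`.
  let b := (((finBasis 𝕜 E').prod (finBasis 𝕜 C)).map
    (Submodule.prodEquivOfIsCompl E' C hC)).reindex finSumFinEquiv
  let α := LinearMap.toContinuousLinearMap b.equivFun.toLinearMap
  have hα : 0 < 1 + ‖α‖ := by positivity
  obtain ⟨y, hyY, hyx, hy⟩ := hY _ (fun i => (b i : X)) (ε / (1 + ε) / (1 + ‖α‖)) (by positivity)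
  let T : E →ₗ[𝕜] Y := b.constr 𝕜 fun i => (⟨y i, hyY i⟩ : Y)
  have hTb : ∀ i, (T (b i) : X) = y i := fun i => by simp [T]
  refine ⟨T, isEpsIsometry_of_abs_sub_le hε.le fun e => ?_, fun e he => ?_⟩
  · have h0 : e = ∑ i, α e i • b i := (b.sum_equivFun e).symm
    have h1 : (e : X) = ∑ i, α e i • (b i : X) := (congrArg E.subtype h0).trans (by
      simp only [map_sum, map_smul, Submodule.subtype_apply])
    have h2 : (T e : X) = ∑ i, α e i • y i := (congrArg (fun e => Y.subtype (T e)) h0).trans (by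
      simp only [map_sum, map_smul, Submodule.subtype_apply, hTb])
    have h3 := hy (α e)
    rw [← h1, ← h2, abs_sub_comm] at h3
    refine h3.trans ?_
    have h4 : ‖α e‖ ≤ (1 + ‖α‖) * ‖e‖ :=
      (α.le_opNorm e).trans (by gcongr; linarith)
    calc _ ≤ ε / (1 + ε) / (1 + ‖α‖) * ((1 + ‖α‖) * ‖e‖) := by gcongr
      _ = _ := by field_simp
  · have h : Y.subtype ∘ₗ T ∘ₗ E'.subtype = E.subtype ∘ₗ E'.subtype := by
      refine (finBasis 𝕜 E').ext fun i => ?_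
      have hb : ((finBasis 𝕜 E' i : E') : E) = b (finSumFinEquiv (Sum.inl i)) := by
        simp [b]
      have hm : ((b (finSumFinEquiv (Sum.inl i)) : E) : X) ∈ Y := by
        rw [← hb]; exact (finBasis 𝕜 E' i).2
      simp only [LinearMap.comp_apply, Submodule.subtype_apply, hb, hTb]
      exact hyx _ hm
    exact LinearMap.congr_fun h ⟨e, he⟩

/-- Every separable subspace is contained in a separable almost isometric ideal. -/
theorem exists_separable_isAlmostIsometricIdeal {Z : Submodule 𝕜 X}
    (hZ : IsSeparable (Z : Set X)) :
    ∃ Y : Submodule 𝕜 X, Z ≤ Y ∧ SeparableSpace Y ∧ IsAlmostIsometricIdeal Y := by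
  let P := {W : Submodule 𝕜 X // IsSeparable (W : Set X)}
  have step : ∀ W : P, ∃ W' : P, W.1 ≤ W'.1 ∧ IsApproximatedBy W.1 W'.1 := fun W => by
    obtain ⟨W', h1, h2, h3⟩ := exists_isApproximatedBy W.2
    exact ⟨⟨W', h2⟩, h1, h3⟩
  choose next hle happ using step
  let W : ℕ → P := fun n => next^[n] ⟨Z, hZ⟩
  have hW : ∀ n, W (n + 1) = next (W n) := fun n => Function.iterate_succ_apply' next n _
  have hmono : Monotone fun n => (W n).1 := monotone_nat_of_le_succ fun n => by
    rw [hW]; exact hle _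
  refine ⟨(⨆ n, (W n).1).topologicalClosure,
    (le_iSup (fun n => (W n).1) 0).trans (Submodule.le_topologicalClosure _), ?_,
    (isApproximatedBy_topologicalClosure_iSup hmono fun n => by
      rw [hW]; exact happ _).isAlmostIsometricIdeal (Submodule.isClosed_topologicalClosure _)⟩
  apply IsSeparable.separableSpace
  have h : ((⨆ n, (W n).1 : Submodule 𝕜 X) : Set X) = ⋃ n, ((W n).1 : Set X) :=
    Submodule.coe_iSup_of_directed _ hmono.directed_le
  rw [Submodule.topologicalClosure_coe, h]
  exact (IsSeparable.iUnion fun n => (W n).2).closure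

end SeparableIdeals

/-! ### Existence of a separable Gurariy space. -/

section Existence

open scoped ENNReal

section EvalFamily

variable {𝕜 : Type*} [RCLike 𝕜] {V : Type*} [NormedAddCommGroup V] [NormedSpace 𝕜 V]
  {I : Type*}

theorem norm_apply_le_of_norm_le_one {φ : StrongDual 𝕜 V} (hφ : ‖φ‖ ≤ 1) (v : V) :
    ‖φ v‖ ≤ ‖v‖ := by
  simpa using φ.le_of_opNorm_le hφ v

/-- The linear isometry into `ℓ^∞` given by a norming family of functionals. -/
noncomputable def evalFamily (φ : I → StrongDual 𝕜 V) (h : ∀ i, ‖φ i‖ ≤ 1)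
    (hφ : ∀ v, ∃ i, φ i v = (‖v‖ : 𝕜)) : V →ₗᵢ[𝕜] lp (fun _ : I => 𝕜) ∞ where
  toFun v := ⟨fun i => φ i v, memℓp_infty ⟨‖v‖, by
    rintro _ ⟨i, rfl⟩; exact norm_apply_le_of_norm_le_one (h i) v⟩⟩
  map_add' v w := by ext i; exact map_add (φ i) v w
  map_smul' c v := by ext i; exact map_smul (φ i) c v
  norm_map' v := by
    obtain ⟨i, hi⟩ := hφ v
    refine le_antisymm (lp.norm_le_of_forall_le (norm_nonneg v) fun i =>
      norm_apply_le_of_norm_le_one (h i) v) ?_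
    refine le_trans (le_of_eq ?_) (lp.norm_apply_le_norm ENNReal.top_ne_zero _ i)
    change ‖v‖ = ‖φ i v‖
    rw [hi, RCLike.norm_ofReal, abs_norm]

/-- Functionals extend along linear isometries without increasing the norm. -/
theorem exists_extension_of_linearIsometry {W : Type*} [NormedAddCommGroup W] [NormedSpace 𝕜 W]
    (T : V →ₗᵢ[𝕜] W) {φ : StrongDual 𝕜 V} (hφ : ‖φ‖ ≤ 1) :
    ∃ ψ : StrongDual 𝕜 W, ‖ψ‖ ≤ 1 ∧ ∀ v, ψ (T v) = φ v := by
  let e := T.equivRange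
  let f : StrongDual 𝕜 (LinearMap.range T.toLinearMap) :=
    φ.comp (e.symm.toContinuousLinearEquiv : _ →L[𝕜] V)
  obtain ⟨ψ, h, hn⟩ := exists_extension_norm_eq _ f
  refine ⟨ψ, hn ▸ ContinuousLinearMap.opNorm_le_bound _ zero_le_one fun x => ?_, fun v => ?_⟩
  · rw [one_mul, ← e.symm.norm_map x]
    exact norm_apply_le_of_norm_le_one hφ _
  · have := h (e v)
    rw [show f (e v) = φ v from congrArg φ (e.symm_apply_apply v)] at this
    exact this

end EvalFamily

section OneStep

variable {𝕜 : Type u} [RCLike 𝕜]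

variable (𝕜) in
/-- An index set for `ℓ^∞`: every functional in the unit ball occurs often enough that its
restrictions to finite-dimensional subspaces can be extended in all possible ways. -/
abbrev BallIndex (X : Type u) [NormedAddCommGroup X] [NormedSpace 𝕜 X] : Type u :=
  {φ : StrongDual 𝕜 X // ‖φ‖ ≤ 1} × (ℕ → 𝕜)

variable (𝕜) in
/-- The canonical isometry of `X` into `ℓ^∞`. -/
noncomputable def ballEmbedding (X : Type u) [NormedAddCommGroup X] [NormedSpace 𝕜 X] :
    X →ₗᵢ[𝕜] lp (fun _ : BallIndex 𝕜 X => 𝕜) ∞ :=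
  evalFamily (fun i => i.1.1) (fun i => i.1.2) fun v => by
    obtain ⟨φ, h1, h2⟩ := exists_dual_vector'' 𝕜 v
    exact ⟨⟨⟨φ, h1⟩, 0⟩, h2⟩

/-- Lets the second component of `BallIndex` code the functionals on `F`, whatever its dimension. -/
theorem exists_surjective_natFun (V : Type*) [AddCommGroup V] [Module 𝕜 V]
    [FiniteDimensional 𝕜 V] : ∃ q : (ℕ → 𝕜) → V, Function.Surjective q := by
  refine ⟨fun m => (finBasis 𝕜 V).equivFun.symm fun i => m i, fun v => ?_⟩
  refine ⟨fun k => if h : k < finrank 𝕜 V then (finBasis 𝕜 V).equivFun v ⟨k, h⟩ else 0, ?_⟩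
  rw [LinearEquiv.symm_apply_eq]
  ext i
  simp

/-- Coordinate `(φ, m)` of `S` is a norm-one-bounded extension of `φ ∘ T`, namely the functional
coded by `m` if that is one, else a Hahn–Banach extension. A norming functional `θ` of `v` occurs as
a coordinate: its restriction to `E` is some `φ ∘ T`, and some `m` codes `θ`. So `S` is exactly
isometric. -/
theorem exists_extension_ballEmbedding {X : Type u} [NormedAddCommGroup X] [NormedSpace 𝕜 X]
    {F : Type*} [NormedAddCommGroup F] [NormedSpace 𝕜 F] [FiniteDimensional 𝕜 F]
    {E : Submodule 𝕜 F} (T : E →ₗᵢ[𝕜] X) :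
    ∃ S : F →ₗᵢ[𝕜] lp (fun _ : BallIndex 𝕜 X => 𝕜) ∞, ∀ e : E, S e = ballEmbedding 𝕜 X (T e) := by
  obtain ⟨q, hq⟩ := exists_surjective_natFun (𝕜 := 𝕜) (StrongDual 𝕜 F)
  have ext : ∀ i : BallIndex 𝕜 X, ∃ ψ : StrongDual 𝕜 F, (‖ψ‖ ≤ 1 ∧ ∀ e : E, ψ e = i.1.1 (T e)) ∧
      ((‖q i.2‖ ≤ 1 ∧ ∀ e : E, q i.2 e = i.1.1 (T e)) → ψ = q i.2) := fun i => by
    by_cases h : ‖q i.2‖ ≤ 1 ∧ ∀ e : E, q i.2 e = i.1.1 (T e)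
    · exact ⟨q i.2, h, fun _ => rfl⟩
    · have hn : ‖i.1.1.comp T.toContinuousLinearMap‖ ≤ 1 :=
        ContinuousLinearMap.opNorm_le_bound _ zero_le_one fun x => by
          rw [one_mul, ← T.norm_map x]
          exact norm_apply_le_of_norm_le_one i.1.2 _
      obtain ⟨ψ, h1, h2⟩ := exists_extension_of_linearIsometry E.subtypeₗᵢ hn
      exact ⟨ψ, ⟨h1, h2⟩, fun h' => absurd h' h⟩
  choose ψ hψ hψq using ext
  refine ⟨evalFamily ψ (fun i => (hψ i).1) fun v => ?_, fun e => ?_⟩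
  · obtain ⟨θ, h1, h2⟩ := exists_dual_vector'' 𝕜 v
    have hn : ‖θ.comp E.subtypeL‖ ≤ 1 :=
      ContinuousLinearMap.opNorm_le_bound _ zero_le_one fun x => by
        rw [one_mul]; exact norm_apply_le_of_norm_le_one h1 _
    obtain ⟨φ, h3, h4⟩ := exists_extension_of_linearIsometry T hn
    obtain ⟨m, rfl⟩ := hq θ
    refine ⟨⟨⟨φ, h3⟩, m⟩, ?_⟩
    rw [hψq ⟨⟨φ, h3⟩, m⟩ ⟨h1, fun e => (h4 e).symm⟩, h2]
  · ext i
    exact (hψ i).2 e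

end OneStep

section Limit

theorem exists_coherent_functionals {𝕜 : Type*} [RCLike 𝕜] (n : ℕ) : ∀ {X : ℕ → Type u}
    [∀ n, NormedAddCommGroup (X n)] [∀ n, NormedSpace 𝕜 (X n)] (ι : ∀ n, X n →ₗᵢ[𝕜] X (n + 1))
    (φ : StrongDual 𝕜 (X n)), ‖φ‖ ≤ 1 →
    ∃ ψ : ∀ k, StrongDual 𝕜 (X k), (∀ k, ‖ψ k‖ ≤ 1) ∧ (∀ k x, ψ (k + 1) (ι k x) = ψ k x) ∧
      ψ n = φ := by
  induction n with
  | zero =>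
    intro X _ _ ι φ hφ
    have step : ∀ k (ψ : {ψ : StrongDual 𝕜 (X k) // ‖ψ‖ ≤ 1}),
        ∃ ψ' : {ψ : StrongDual 𝕜 (X (k + 1)) // ‖ψ‖ ≤ 1}, ∀ x, ψ'.1 (ι k x) = ψ.1 x := by
      intro k ψ
      obtain ⟨ψ', h1, h2⟩ := exists_extension_of_linearIsometry (ι k) ψ.2
      exact ⟨⟨ψ', h1⟩, h2⟩
    choose next hnext using step
    let ψ : ∀ k, {ψ : StrongDual 𝕜 (X k) // ‖ψ‖ ≤ 1} := fun k => Nat.rec ⟨φ, hφ⟩ next k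
    exact ⟨fun k => (ψ k).1, fun k => (ψ k).2, fun k x => hnext k (ψ k) x, rfl⟩
  | succ n ih =>
    intro X _ _ ι φ hφ
    -- The tower is shifted by one; the missing functional on `X 0` is a restriction.
    obtain ⟨ψ, h1, h2, h3⟩ := ih (X := fun k => X (k + 1)) (fun k => ι (k + 1)) φ hφ
    refine ⟨fun k => Nat.casesOn k ((ψ 0).comp (ι 0).toContinuousLinearMap) ψ, ?_, ?_, h3⟩
    · rintro (_ | k)
      · refine ContinuousLinearMap.opNorm_le_bound _ zero_le_one fun x => ?_
        rw [one_mul, ← (ι 0).norm_map x]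
        exact norm_apply_le_of_norm_le_one (h1 0) _
      · exact h1 k
    · rintro (_ | k) x
      · rfl
      · exact h2 k x

/-- Every sequence of isometric embeddings has a complete limit. -/
theorem exists_limit {𝕜 : Type u} [RCLike 𝕜] {X : ℕ → Type u}
    [∀ n, NormedAddCommGroup (X n)] [∀ n, NormedSpace 𝕜 (X n)]
    (ι : ∀ n, X n →ₗᵢ[𝕜] X (n + 1)) :
    ∃ (Z : Type u) (_ : NormedAddCommGroup Z) (_ : NormedSpace 𝕜 Z) (j : ∀ n, X n →ₗᵢ[𝕜] Z),
      CompleteSpace Z ∧ (∀ n x, j (n + 1) (ι n x) = j n x) ∧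
      ∀ z, ∀ δ > 0, ∃ n x, ‖z - j n x‖ < δ := by
  -- Coherent sequences of functionals are coordinates of one `ℓ^∞` containing every `X n`
  -- compatibly; the limit is the closure of the union.
  let I := {ψ : ∀ k, StrongDual 𝕜 (X k) // (∀ k, ‖ψ k‖ ≤ 1) ∧ ∀ k x, ψ (k + 1) (ι k x) = ψ k x}
  let j : ∀ n, X n →ₗᵢ[𝕜] lp (fun _ : I => 𝕜) ∞ := fun n =>
    evalFamily (fun ψ => ψ.1 n) (fun ψ => ψ.2.1 n) fun v => by
      obtain ⟨φ, h1, h2⟩ := exists_dual_vector'' 𝕜 v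
      obtain ⟨ψ, h3, h4, rfl⟩ := exists_coherent_functionals n ι φ h1
      exact ⟨⟨ψ, h3, h4⟩, h2⟩
  have hj : ∀ n x, j (n + 1) (ι n x) = j n x := fun n x => by
    ext ψ
    exact ψ.2.2 n x
  let D := ⨆ n, LinearMap.range (j n).toLinearMap
  have hmono : Monotone fun n => LinearMap.range (j n).toLinearMap :=
    monotone_nat_of_le_succ fun n => by
      rintro _ ⟨x, rfl⟩
      exact ⟨ι n x, hj n x⟩
  have hD : ∀ n x, j n x ∈ D.topologicalClosure := fun n x =>
    D.le_topologicalClosure (Submodule.mem_iSup_of_mem n ⟨x, rfl⟩)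
  refine ⟨D.topologicalClosure, inferInstance, inferInstance,
    fun n => ⟨(j n).toLinearMap.codRestrict _ (hD n), fun x => (j n).norm_map x⟩,
    D.isClosed_topologicalClosure.completeSpace_coe, fun n x => Subtype.ext (hj n x),
    fun z δ hδ => ?_⟩
  obtain ⟨y, hy, hd⟩ := Metric.mem_closure_iff.1 z.2 δ hδ
  obtain ⟨n, x, rfl⟩ := (Submodule.mem_iSup_of_directed _ hmono.directed_le).1 hy
  exact ⟨n, x, by rw [dist_eq_norm] at hd; exact hd⟩

variable {𝕜 : Type u} [RCLike 𝕜] {X : ℕ → Type u} [∀ n, NormedAddCommGroup (X n)]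
  [∀ n, NormedSpace 𝕜 (X n)] {ι : ∀ n, X n →ₗᵢ[𝕜] X (n + 1)}
  {Z : Type u} [NormedAddCommGroup Z] [NormedSpace 𝕜 Z] {j : ∀ n, X n →ₗᵢ[𝕜] Z}

theorem exists_approximation_of_dense (hj : ∀ n x, j (n + 1) (ι n x) = j n x)
    (hd : ∀ z, ∀ δ > 0, ∃ n x, ‖z - j n x‖ < δ) {E : Type*} [NormedAddCommGroup E]
    [NormedSpace 𝕜 E] [FiniteDimensional 𝕜 E] (T : E →ₗ[𝕜] Z) {δ : ℝ} (hδ : 0 < δ) :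
    ∃ (N : ℕ) (T' : E →ₗ[𝕜] X N), ∀ e, ‖T e - j N (T' e)‖ ≤ δ * ‖e‖ := by
  have hmono : ∀ n m, n ≤ m → ∀ x, ∃ y, j m y = j n x := fun n m h x => by
    induction m, h using Nat.le_induction with
    | base => exact ⟨x, rfl⟩
    | succ m _ ih =>
      obtain ⟨y, hy⟩ := ih
      exact ⟨ι m y, (hj m y).trans hy⟩
  let b := finBasis 𝕜 E
  let α := LinearMap.toContinuousLinearMap b.equivFun.toLinearMap
  set η := δ / (finrank 𝕜 E * ‖α‖ + 1) with hη
  have hη0 : 0 < η := by positivity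
  choose n x hx using fun i => hd (T (b i)) η hη0
  let N := Finset.univ.sup n
  choose y hy using fun i => hmono (n i) N (Finset.le_sup (Finset.mem_univ i)) (x i)
  refine ⟨N, b.constr 𝕜 y, fun e => ?_⟩
  have h0 : e = ∑ i, α e i • b i := (b.sum_equivFun e).symm
  have h1 : T e - j N (b.constr 𝕜 y e) = ∑ i, α e i • (T (b i) - j N (y i)) :=
    (congrArg (T - (j N).toLinearMap ∘ₗ b.constr 𝕜 y : E →ₗ[𝕜] Z) h0).trans (by
      simp only [map_sum, map_smul, LinearMap.sub_apply, LinearMap.comp_apply,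
        Basis.constr_basis, LinearIsometry.coe_toLinearMap])
  rw [h1]
  have h2 : ∀ i ∈ Finset.univ, ‖α e i • (T (b i) - j N (y i))‖ ≤ ‖α‖ * ‖e‖ * η := fun i _ => by
    rw [norm_smul, hy i]
    gcongr
    · exact (norm_le_pi_norm (α e) i).trans (α.le_opNorm e)
    · exact (hx i).le
  refine (norm_sum_le _ _).trans ((Finset.sum_le_card_nsmul _ _ _ h2).trans ?_)
  simp only [Finset.card_univ, Fintype.card_fin, nsmul_eq_mul]
  have h3 : (finrank 𝕜 E : ℝ) * ‖α‖ * η ≤ δ := by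
    rw [hη, mul_div_assoc', div_le_iff₀ (by positivity)]
    nlinarith
  calc (finrank 𝕜 E : ℝ) * (‖α‖ * ‖e‖ * η) = finrank 𝕜 E * ‖α‖ * η * ‖e‖ := by ring
    _ ≤ _ := by gcongr

/-- `T` is perturbed into some `X N`, made isometric by renorming, and extended one stage up. The
extension is only near `T` on `E`; the error, composed with a projection `P` onto `E`, is added
back. -/
theorem isGurariy_of_limit (hj : ∀ n x, j (n + 1) (ι n x) = j n x)
    (hd : ∀ z, ∀ δ > 0, ∃ n x, ‖z - j n x‖ < δ)
    (hX : ∀ (n : ℕ) (F : Type u) [NormedAddCommGroup F] [NormedSpace 𝕜 F]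
      [FiniteDimensional 𝕜 F] (E : Submodule 𝕜 F) (T : E →ₗᵢ[𝕜] X n),
      ∃ S : F →ₗᵢ[𝕜] X (n + 1), ∀ e : E, S e = ι n (T e)) : IsGurariy 𝕜 Z := by
  intro ε hε F _ _ _ E T
  obtain ⟨P, hP⟩ := E.subtype.exists_leftInverse_of_injective (by simp)
  set C := ‖LinearMap.toContinuousLinearMap P‖
  have hC : ∀ x, ‖P x‖ ≤ C * ‖x‖ := (LinearMap.toContinuousLinearMap P).le_opNorm
  have hC0 : 0 < 1 + C := by positivity
  -- Chosen so that `δ * (1 + C)`, the defect `δ` of `S₁` plus the correction `δ * C`, is `ε / (1 +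
  -- ε)`.
  set δ := ε / (1 + ε) / (1 + C)
  have hδ0 : 0 < δ := by positivity
  have hδ1 : δ / (1 + δ) ≤ δ := div_le_self hδ0.le (by linarith)
  obtain ⟨N, T', hT'⟩ := exists_approximation_of_dense hj hd T.toLinearMap
    (show 0 < δ / (1 + δ) by positivity)
  have hT'' : IsEpsIsometry δ T' := isEpsIsometry_of_abs_sub_le hδ0.le fun e => by
    refine le_trans ?_ (hT' e)
    rw [abs_sub_comm, ← (j N).norm_map (T' e), ← T.norm_map e]
    exact abs_norm_sub_norm_le _ _
  obtain ⟨F', _, _, φ, hφ, hφE⟩ := exists_renorming.{u} hδ0.le hT''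
  have : FiniteDimensional 𝕜 F' := φ.finiteDimensional
  let ψ := φ.submoduleMap E
  let R : (E.map (φ : F →ₗ[𝕜] F')) →ₗᵢ[𝕜] X N :=
    { toLinearMap := T' ∘ₗ ψ.symm.toLinearMap
      norm_map' := fun x => by
        obtain ⟨e, rfl⟩ := ψ.surjective x
        simp only [LinearMap.comp_apply, LinearEquiv.coe_coe, LinearEquiv.symm_apply_apply]
        exact (hφE e).symm }
  have hR : ∀ e, R (ψ e) = T' e := fun e => congrArg T' (ψ.symm_apply_apply e)
  obtain ⟨S, hS⟩ := hX N F' _ R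
  let S₁ : F →ₗ[𝕜] Z := (j (N + 1)).toLinearMap ∘ₗ S.toLinearMap ∘ₗ φ.toLinearMap
  have hS₁ : ∀ x, |‖S₁ x‖ - ‖x‖| ≤ δ * ‖x‖ := fun x => by
    have h1 : ‖S₁ x‖ = ‖φ x‖ := ((j (N + 1)).norm_map _).trans (S.norm_map _)
    have h2 := (isEpsIsometry_iff hδ0.le).1 hφ x
    simp only [LinearEquiv.coe_coe] at h2
    rw [h1, abs_le]
    have h3 : ‖φ x‖ * (1 + δ) ≥ ‖x‖ := by linarith
    constructor
    · by_contra! h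
      nlinarith [mul_nonneg (mul_nonneg hδ0.le hδ0.le) (norm_nonneg x)]
    · linarith
  have hS₁E : ∀ e : E, S₁ e = j N (T' e) := fun e => by
    have := hS (ψ e)
    rw [hR] at this
    rw [← hj N (T' e), ← this]
    rfl
  refine ⟨S₁ + (T.toLinearMap - S₁ ∘ₗ E.subtype) ∘ₗ P,
    isEpsIsometry_of_abs_sub_le hε.le fun x => ?_, fun e => ?_⟩
  · simp only [LinearMap.add_apply, LinearMap.comp_apply, LinearMap.sub_apply,
      Submodule.subtype_apply, LinearIsometry.coe_toLinearMap, hS₁E]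
    have h1 := hT' (P x)
    rw [LinearIsometry.coe_toLinearMap] at h1
    have h2 : |‖S₁ x + (T (P x) - j N (T' (P x)))‖ - ‖S₁ x‖| ≤ δ * (C * ‖x‖) := by
      refine (abs_norm_sub_norm_le _ _).trans ?_
      rw [add_sub_cancel_left]
      exact h1.trans (by gcongr; exact hC x)
    refine (abs_sub_le _ ‖S₁ x‖ _).trans ((add_le_add h2 (hS₁ x)).trans (le_of_eq ?_))
    have : ε / (1 + ε) = δ * (1 + C) := (div_mul_cancel₀ _ hC0.ne').symm
    rw [this]; ring
  · have h : P e = e := LinearMap.congr_fun hP e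
    simp [h]

end Limit

/-- A normed space together with its structure. -/
structure BundledSpace (𝕜 : Type u) [RCLike 𝕜] : Type (u + 1) where
  carrier : Type u
  [group : NormedAddCommGroup carrier]
  [space : NormedSpace 𝕜 carrier]

attribute [instance] BundledSpace.group BundledSpace.space

/-- The iterated `ℓ^∞` spaces over the unit balls of the duals. -/
noncomputable def ballTower (𝕜 : Type u) [RCLike 𝕜] : ℕ → BundledSpace 𝕜
  | 0 => ⟨𝕜⟩
  | n + 1 => ⟨lp (fun _ : BallIndex 𝕜 (ballTower 𝕜 n).carrier => 𝕜) ∞⟩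

/-- The canonical isometry of each term of `ballTower` into the next. -/
noncomputable def ballTowerEmbedding (𝕜 : Type u) [RCLike 𝕜] (n : ℕ) :
    (ballTower 𝕜 n).carrier →ₗᵢ[𝕜] (ballTower 𝕜 (n + 1)).carrier :=
  ballEmbedding 𝕜 (ballTower 𝕜 n).carrier

theorem exists_complete_isGurariy (𝕜 : Type u) [RCLike 𝕜] :
    ∃ (Z : Type u) (_ : NormedAddCommGroup Z) (_ : NormedSpace 𝕜 Z),
      CompleteSpace Z ∧ IsGurariy 𝕜 Z := by
  obtain ⟨Z, _, _, j, hc, hj, hd⟩ := exists_limit fun n => ballTowerEmbedding 𝕜 n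
  exact ⟨Z, _, _, hc, isGurariy_of_limit hj hd fun n F _ _ _ E T =>
    exists_extension_ballEmbedding T⟩

theorem exists_isSeparableGurariy (𝕜 : Type u) [RCLike 𝕜] :
    ∃ (G : Type u) (_ : NormedAddCommGroup G) (_ : NormedSpace 𝕜 G), IsSeparableGurariy 𝕜 G := by
  obtain ⟨Z, _, _, _, hZ⟩ := exists_complete_isGurariy 𝕜
  obtain ⟨Y, -, hs, hY⟩ := exists_separable_isAlmostIsometricIdeal (Z := (⊥ : Submodule 𝕜 Z))
    (by simpa using (Set.countable_singleton (0 : Z)).isSeparable)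
  exact ⟨Y, inferInstance, inferInstance, hY.isClosed.completeSpace_coe, hs,
    hZ.of_isAlmostIsometricIdeal hY⟩

end Existence

/-! ### Separable determination of the Gurariy property, and the theorem. -/

theorem isGurariy_of_forall_separable_ideal {𝕜 : Type u} [RCLike 𝕜] {X : Type v}
    [NormedAddCommGroup X] [NormedSpace 𝕜 X]
    (h : ∀ Y : Submodule 𝕜 X, TopologicalSpace.SeparableSpace Y → IsAlmostIsometricIdeal Y →
      IsGurariy 𝕜 Y) : IsGurariy 𝕜 X := by
  intro ε hε F _ _ _ E T
  obtain ⟨Y, hTY, hs, hY⟩ := exists_separable_isAlmostIsometricIdeal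
    (Z := LinearMap.range T.toLinearMap) (by
      have := FiniteDimensional.proper 𝕜 (LinearMap.range T.toLinearMap)
      exact .of_subtype _)
  obtain ⟨S, hS, hST⟩ := h Y hs hY ε hε F E
    ⟨T.toLinearMap.codRestrict Y fun e => hTY ⟨e, rfl⟩, fun e => T.norm_map e⟩
  exact ⟨Y.subtype ∘ₗ S, hS, fun e => congrArg Subtype.val (hST e)⟩

end GurariySpace

theorem mainTheorem6 {𝕜 : Type u} [RCLike 𝕜]
    {X : Type v} [NormedAddCommGroup X] [NormedSpace 𝕜 X] [CompleteSpace X] :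
    (∃ (G : Type u) (_ : NormedAddCommGroup G) (_ : NormedSpace 𝕜 G),
      GurariySpace.IsSeparableGurariy 𝕜 G) ∧
    ∀ (G : Type w) [NormedAddCommGroup G] [NormedSpace 𝕜 G],
      GurariySpace.IsSeparableGurariy 𝕜 G →
      (GurariySpace.IsGurariy 𝕜 X ↔
        ∀ Y : Submodule 𝕜 X, TopologicalSpace.SeparableSpace Y →
          GurariySpace.IsAlmostIsometricIdeal Y → GurariySpace.AlmostIsometric 𝕜 Y G) := by
  refine ⟨GurariySpace.exists_isSeparableGurariy 𝕜, fun G _ _ hG => ⟨fun hX Y hs hY => ?_,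
    fun h => GurariySpace.isGurariy_of_forall_separable_ideal fun Y hs hY =>
      hG.gurariy.of_almostIsometric (h Y hs hY)⟩⟩
  exact GurariySpace.IsSeparableGurariy.almostIsometric
    ⟨hY.isClosed.completeSpace_coe, hs, hX.of_isAlmostIsometricIdeal hY⟩ hG
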